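/- For every integer $d\ge 3$ there is a constant $c_d>0$, depending only on $d$, such that for every integer $n>d+1$ there exist $n$ pairwise disjoint nonempty convex sets $K_1,\dots,K_n\subset\mathbb{R}^d$ that encapsulate at least $c_d\, n^{\lfloor (d+1)/2\rfloor}$ points. Here a point $p\in\mathbb{R}^d$ is \emph{encapsulated} by $K_1,\dots,K_n$ if for some $\epsilon>0$ we have $B(p,\epsilon)\setminus\bigcup_{i=1}^n K_i=\{p\}$, where $B(p,\epsilon)$ is the open Euclidean ball of radius $\epsilon$ centered at $p$. -/

import Mathlib

/-- A point `p` of `ℝ^d` is encapsulated by the sets `K i` if they cover a neighborhood of `p`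
except for the point `p` itself, which they do not cover. -/
def IsEncapsulated {d : ℕ} {ι : Type*} (K : ι → Set (EuclideanSpace ℝ (Fin d)))
    (p : EuclideanSpace ℝ (Fin d)) : Prop :=
  ∃ ε : ℝ, 0 < ε ∧ Metric.ball p ε \ (⋃ i, K i) = {p}

/-! Take the lower envelope of the affine functions `momentForm i`, `i < n`: each cell, where one of
them is minimal, is convex. A vertex of the envelope is extreme in every cell containing it, so
deleting it keeps the cells convex and leaves exactly a hole (`exists_convex_encapsulating`). Many
vertices arise as in cyclic polytopes (Gale evenness). A monic polynomial of degree `d + 1` whose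
simple roots are pairs of consecutive integers, plus `0` if `d + 1` is odd, is nonnegative on the
naturals. Its coefficients of degrees `1, …, d` give a point where the `d + 1` root indices attain
the minimum together. Choosing one pair in each of `k = (d + 1) / 2` blocks of `m` pairs gives `m ^
k` vertices. -/

/-- The monic polynomial of degree `d + 1` without constant term whose other coefficients are the
coordinates of `x`, evaluated at `t`. For fixed `t` it is affine in `x`. -/
noncomputable def momentForm {d : ℕ} (t : ℝ) (x : EuclideanSpace ℝ (Fin d)) : ℝ :=
  t ^ (d + 1) + ∑ k : Fin d, x k * t ^ ((k : ℕ) + 1)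

/-- The functions `momentForm t` are affine. -/
theorem momentForm_combo {d : ℕ} (t : ℝ) (x y : EuclideanSpace ℝ (Fin d)) {a b : ℝ}
    (hab : a + b = 1) :
    momentForm t (a • x + b • y) = a * momentForm t x + b * momentForm t y := by
  have h : ∑ k : Fin d, (a • x + b • y) k * t ^ ((k : ℕ) + 1)
      = a * ∑ k : Fin d, x k * t ^ ((k : ℕ) + 1) + b * ∑ k : Fin d, y k * t ^ ((k : ℕ) + 1) := by
    rw [Finset.mul_sum, Finset.mul_sum, ← Finset.sum_add_distrib]
    refine Finset.sum_congr rfl fun k _ => ?_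
    simp only [PiLp.add_apply, PiLp.smul_apply, smul_eq_mul]
    ring
  unfold momentForm
  rw [h]
  linear_combination (-t ^ (d + 1)) * hab

/-- The point of `ℝ^d` given by the coefficients of degrees `1, …, d` of a polynomial. -/
noncomputable def coeffPoint (d : ℕ) (Q : Polynomial ℝ) : EuclideanSpace ℝ (Fin d) :=
  WithLp.toLp 2 fun k => Q.coeff ((k : ℕ) + 1)

theorem momentForm_coeffPoint {d : ℕ} {Q : Polynomial ℝ} (hQ : Q.Monic)
    (hdeg : Q.natDegree = d + 1) (t : ℝ) :
    momentForm t (coeffPoint d Q) = Q.eval t - Q.coeff 0 := by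
  have hlead : Q.coeff (d + 1) = 1 := hdeg ▸ hQ.coeff_natDegree
  rw [Polynomial.eval_eq_sum_range, hdeg, Finset.sum_range_succ, Finset.sum_range_succ', hlead,
    ← Fin.sum_univ_eq_sum_range (fun k => Q.coeff (k + 1) * t ^ (k + 1))]
  simp only [momentForm, coeffPoint]
  ring

/-- A point is determined by the differences of its moment forms at `d + 1` distinct parameters. -/
theorem eq_of_momentForm_sub_const {d : ℕ} {x y : EuclideanSpace ℝ (Fin d)} {T : Finset ℝ}
    (hT : d < T.card) {c : ℝ} (h : ∀ t ∈ T, momentForm t x - momentForm t y = c) : x = y := by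
  -- The constant `c` fills the free degree-`0` slot, so `D` has degree at most `d` but more than
  -- `d` roots.
  let D : Polynomial ℝ :=
    ∑ k : Fin d, Polynomial.monomial ((k : ℕ) + 1) (x k - y k) - Polynomial.C c
  have heval : ∀ t ∈ T, D.eval t = 0 := by
    intro t ht
    rw [← sub_eq_zero.2 (h t ht)]
    simp only [D, momentForm, Polynomial.eval_sub, Polynomial.eval_finsetSum,
      Polynomial.eval_monomial, Polynomial.eval_C, sub_mul, Finset.sum_sub_distrib]
    ring
  have hdeg : D.natDegree ≤ d := by
    refine (Polynomial.natDegree_sub_le _ _).trans (max_le ?_ (by simp))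
    refine Polynomial.natDegree_sum_le_of_forall_le _ _ fun k _ => ?_
    exact (Polynomial.natDegree_monomial_le _).trans k.2
  have hD : D = 0 := by
    by_contra hne
    have hsub : T ⊆ D.roots.toFinset := fun t ht => by
      simpa [hne] using heval t ht
    have h1 := (Finset.card_le_card hsub).trans (Multiset.toFinset_card_le _)
    have h2 := D.card_roots'
    omega
  ext k
  have hk : D.coeff ((k : ℕ) + 1) = 0 := by rw [hD, Polynomial.coeff_zero]
  have hk' : D.coeff ((k : ℕ) + 1) = x k - y k := by
    simp [D, Polynomial.coeff_monomial, Fin.val_inj]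
  linarith

/-- The lower envelope of affine functions `f i` splits `ℝ^d` into convex cells. Points where
enough of the minimal functions agree are extreme in each cell, so that the cells without these
points are still convex and encapsulate them. -/
theorem exists_convex_encapsulating {d n : ℕ} (hd : 0 < d) (hn : 0 < n)
    (f : Fin n → EuclideanSpace ℝ (Fin d) → ℝ)
    (hf : ∀ i x y (a b : ℝ), a + b = 1 → f i (a • x + b • y) = a * f i x + b * f i y)
    (S : Finset (EuclideanSpace ℝ (Fin d)))
    (hS : ∀ p ∈ S, ∀ i x, (∀ j, f i p ≤ f j p) → (∀ j, f j p = f i p → f j x = f i x) → x = p) :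
    ∃ K : Fin n → Set (EuclideanSpace ℝ (Fin d)),
      (∀ i, Convex ℝ (K i)) ∧ (∀ i, (K i).Nonempty) ∧
      (∀ i j, i ≠ j → Disjoint (K i) (K j)) ∧ ∀ p ∈ S, IsEncapsulated K p := by
  classical
  obtain ⟨R, hR0, hR⟩ : ∃ R : ℝ, 0 < R ∧ (S : Set (EuclideanSpace ℝ (Fin d))) ⊆ Metric.ball 0 R :=
    S.finite_toSet.isBounded.subset_ball_lt 0 0
  -- Ties go to the least index, for disjointness. The bounded ball leaves room outside for the
  -- points `q i`, which replace empty cells.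
  let cell : Fin n → Set (EuclideanSpace ℝ (Fin d)) := fun i =>
    {x | x ∈ Metric.ball 0 R ∧ x ∉ S ∧ (∀ j, f i x ≤ f j x) ∧ ∀ j < i, f i x < f j x}
  let q : Fin n → EuclideanSpace ℝ (Fin d) := fun i =>
    EuclideanSpace.single ⟨0, hd⟩ (R + (i : ℕ))
  have hq : ∀ i, q i ∉ Metric.ball (0 : EuclideanSpace ℝ (Fin d)) R := by
    intro i hi
    have h0 : (0 : ℝ) ≤ R + (i : ℕ) := by positivity
    rw [mem_ball_zero_iff, PiLp.norm_single, Real.norm_of_nonneg h0] at hi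
    have : (0 : ℝ) ≤ (i : ℕ) := by positivity
    linarith
  have hqinj : Function.Injective q := by
    intro i j hij
    have h := congrArg (fun v : EuclideanSpace ℝ (Fin d) => v ⟨0, hd⟩) hij
    simpa [q, Fin.val_inj] using h
  have hconv : ∀ i, Convex ℝ (cell i) := by
    intro i
    rw [convex_iff_forall_pos]
    rintro x ⟨hxR, hxS, hx, hx'⟩ y ⟨hyR, hyS, hy, hy'⟩ a b ha hb hab
    refine ⟨convex_ball _ _ hxR hyR ha.le hb.le hab, fun hz => ?_, fun j => ?_, fun j hj => ?_⟩
    -- A function tied with `f i` at the combination is at least `f i` at both endpoints, hence tied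
    -- at `x`; then `hS` makes `x` the deleted point.
    · refine hxS ?_
      rw [hS _ hz i x (fun j => ?_) fun j hj => ?_]
      · exact hz
      · rw [hf _ _ _ _ _ hab, hf _ _ _ _ _ hab]
        have := hx j
        have := hy j
        gcongr
      · rw [hf _ _ _ _ _ hab, hf _ _ _ _ _ hab] at hj
        refine le_antisymm (le_of_not_gt fun hlt => ?_) (hx j)
        have h1 := mul_lt_mul_of_pos_left hlt ha
        have h2 := mul_le_mul_of_nonneg_left (hy j) hb.le
        linarith
    · rw [hf _ _ _ _ _ hab, hf _ _ _ _ _ hab]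
      have := hx j
      have := hy j
      gcongr
    · rw [hf _ _ _ _ _ hab, hf _ _ _ _ _ hab]
      have := hx' j hj
      have := hy' j hj
      gcongr
  have hcellq : ∀ i j, q j ∉ cell i := fun i j h => hq j h.1
  have hdisj : ∀ i j, i ≠ j → Disjoint (cell i) (cell j) := by
    intro i j hij
    rw [Set.disjoint_left]
    rintro x ⟨-, -, hi, hi'⟩ ⟨-, -, hj, hj'⟩
    rcases lt_or_gt_of_ne hij with h | h
    · exact absurd (hj' i h) (not_lt.2 (hi j))
    · exact absurd (hi' j h) (not_lt.2 (hj i))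
  have hcover : ∀ x ∈ Metric.ball (0 : EuclideanSpace ℝ (Fin d)) R, x ∉ S → ∃ i, x ∈ cell i := by
    intro x hxR hxS
    have : Nonempty (Fin n) := ⟨⟨0, hn⟩⟩
    obtain ⟨i₀, hi₀⟩ := Finite.exists_min fun i => f i x
    let A : Finset (Fin n) := Finset.univ.filter fun i => ∀ j, f i x ≤ f j x
    have hA : A.Nonempty := ⟨i₀, by simpa [A] using hi₀⟩
    have hmem : ∀ j, f (A.min' hA) x ≤ f j x := by
      simpa [A] using A.min'_mem hA
    refine ⟨A.min' hA, hxR, hxS, hmem, fun j hj => lt_of_le_of_ne (hmem j) fun he => ?_⟩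
    exact absurd (A.min'_le j (by simpa [A, ← he] using hmem)) (not_le.2 hj)
  refine ⟨fun i => if (cell i).Nonempty then cell i else {q i}, fun i => ?_, fun i => ?_,
    fun i j hij => ?_, fun p hp => ?_⟩
  · dsimp only
    split_ifs
    · exact hconv i
    · exact convex_singleton _
  · dsimp only
    split_ifs with h
    · exact h
    · exact Set.singleton_nonempty _
  · dsimp only
    split_ifs
    · exact hdisj i j hij
    · exact Set.disjoint_singleton_right.2 (hcellq i j)
    · exact Set.disjoint_singleton_left.2 (hcellq j i)
    · exact Set.disjoint_singleton.2 (hqinj.ne hij)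
  · have hopen : IsOpen (Metric.ball (0 : EuclideanSpace ℝ (Fin d)) R ∩
        ((S.erase p : Finset _) : Set (EuclideanSpace ℝ (Fin d)))ᶜ) :=
      Metric.isOpen_ball.inter (S.erase p).finite_toSet.isClosed.isOpen_compl
    obtain ⟨ε, hε, hball⟩ := Metric.isOpen_iff.1 hopen p ⟨hR hp, by simp⟩
    refine ⟨ε, hε, Set.Subset.antisymm ?_ ?_⟩
    · rintro x ⟨hx, hxK⟩
      by_contra hne
      obtain ⟨hxR, hxS⟩ := hball hx
      obtain ⟨i, hi⟩ := hcover x hxR fun h => hxS (by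
        exact Finset.mem_coe.2 (Finset.mem_erase.2 ⟨hne, h⟩))
      refine hxK (Set.mem_iUnion.2 ⟨i, ?_⟩)
      rwa [if_pos ⟨x, hi⟩]
    · rintro x rfl
      refine ⟨Metric.mem_ball_self hε, fun h => ?_⟩
      obtain ⟨i, hi⟩ := Set.mem_iUnion.1 h
      split_ifs at hi
      · exact hi.2.1 hp
      · exact hq i (Set.mem_singleton_iff.1 hi ▸ hR hp)

/-- The start of the `j`-th chosen pair of consecutive integers; the `j`-th pair is chosen among
the `m` pairs of its block, and all pairs are shifted by `e`. -/
def pairStart {k m : ℕ} (e : ℕ) (g : Fin k → Fin m) (j : Fin k) : ℕ :=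
  e + 2 * (m * j + g j)

/-- The union of the chosen pairs of consecutive integers, together with `{0, …, e - 1}`. -/
def pairSet {k m : ℕ} (e : ℕ) (g : Fin k → Fin m) : Finset ℕ :=
  Finset.range e ∪ Finset.univ.image (fun z : Fin k × Fin 2 => pairStart e g z.1 + z.2)

theorem block_inj {m a b r s : ℕ} (hr : r < m) (hs : s < m) (h : m * a + r = m * b + s) :
    a = b ∧ r = s := by
  have hm : 0 < m := by omega
  have h1 := congrArg (· / m) h
  have h2 := congrArg (· % m) h
  simp only [Nat.mul_add_div hm, Nat.mul_add_mod, Nat.div_eq_of_lt hr, Nat.div_eq_of_lt hs,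
    Nat.mod_eq_of_lt hr, Nat.mod_eq_of_lt hs] at h1 h2
  exact ⟨by simpa using h1, h2⟩

theorem pairStart_add_inj {k m e : ℕ} {g g' : Fin k → Fin m} {j j' : Fin k} {s s' : Fin 2}
    (h : pairStart e g j + s = pairStart e g' j' + s') : j = j' ∧ g j = g' j' ∧ s = s' := by
  unfold pairStart at h
  have hs := s.2
  have hs' := s'.2
  obtain ⟨h1, h2⟩ := block_inj (a := j) (b := j') (g j).2 (g' j').2 (by omega)
  exact ⟨Fin.ext h1, Fin.ext h2, Fin.ext (by omega)⟩

theorem card_pairSet {k m : ℕ} (e : ℕ) (g : Fin k → Fin m) :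
    (pairSet e g).card = e + 2 * k := by
  rw [pairSet, Finset.card_union_of_disjoint, Finset.card_image_of_injective]
  · simp [mul_comm]
  · rintro ⟨j, s⟩ ⟨j', s'⟩ h
    obtain ⟨h1, -, h2⟩ := pairStart_add_inj h
    exact Prod.ext h1 h2
  · rw [Finset.disjoint_left]
    intro a ha ha'
    simp only [Finset.mem_range, Finset.mem_image, pairStart] at ha ha'
    obtain ⟨z, -, hz⟩ := ha'
    omega

theorem pairSet_injective {k m : ℕ} (e : ℕ) :
    Function.Injective (pairSet e : (Fin k → Fin m) → Finset ℕ) := by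
  intro g g' h
  funext j
  have hj : pairStart e g j + ((0 : Fin 2) : ℕ) ∈ pairSet e g' :=
    h ▸ Finset.mem_union_right _ (Finset.mem_image_of_mem _ (Finset.mem_univ (j, (0 : Fin 2))))
  rcases Finset.mem_union.1 hj with hj | hj
  · rw [Finset.mem_range, pairStart] at hj
    omega
  · obtain ⟨⟨j', s⟩, -, hz⟩ := Finset.mem_image.1 hj
    obtain ⟨rfl, h2, -⟩ := pairStart_add_inj hz
    exact h2.symm

theorem lt_of_mem_pairSet {k m e a : ℕ} {g : Fin k → Fin m} (ha : a ∈ pairSet e g) :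
    a < e + 2 * (m * k) := by
  rcases Finset.mem_union.1 ha with h | h
  · have := Finset.mem_range.1 h
    omega
  · obtain ⟨⟨j, s⟩, -, rfl⟩ := Finset.mem_image.1 h
    have h1 : m * (j + 1) ≤ m * k := Nat.mul_le_mul_left m j.2
    have h2 := (g j).2
    have h3 := s.2
    simp only [pairStart]
    rw [mul_add, mul_one] at h1
    omega

/-- The monic polynomial with simple roots at the integers of `pairSet e g`. -/
noncomputable def pairPoly {k m : ℕ} (e : ℕ) (g : Fin k → Fin m) : Polynomial ℝ :=
  ∏ a ∈ pairSet e g, (Polynomial.X - Polynomial.C (a : ℝ))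

theorem pairPoly_monic {k m : ℕ} (e : ℕ) (g : Fin k → Fin m) : (pairPoly e g).Monic :=
  Polynomial.monic_prod_of_monic _ _ fun _ _ => Polynomial.monic_X_sub_C _

theorem natDegree_pairPoly {k m : ℕ} (e : ℕ) (g : Fin k → Fin m) :
    (pairPoly e g).natDegree = e + 2 * k := by
  rw [pairPoly, Polynomial.natDegree_prod_of_monic _ _ fun _ _ => Polynomial.monic_X_sub_C _]
  simp only [Polynomial.natDegree_X_sub_C, Finset.sum_const, card_pairSet, smul_eq_mul, mul_one]

theorem eval_pairPoly_eq_zero_iff {k m e : ℕ} {g : Fin k → Fin m} {i : ℕ} :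
    (pairPoly e g).eval (i : ℝ) = 0 ↔ i ∈ pairSet e g := by
  simp [pairPoly, Polynomial.eval_prod, Finset.prod_eq_zero_iff, sub_eq_zero]

/-- A polynomial whose roots come in pairs of consecutive integers is nonnegative at integers. -/
theorem eval_pairPoly_nonneg {k m e : ℕ} (he : e ≤ 1) (g : Fin k → Fin m) (i : ℕ) :
    0 ≤ (pairPoly e g).eval (i : ℝ) := by
  rw [pairPoly, Polynomial.eval_prod, pairSet, Finset.prod_union, Finset.prod_image,
    Fintype.prod_prod_type]
  · refine mul_nonneg (Finset.prod_nonneg fun a ha => ?_) (Finset.prod_nonneg fun j _ => ?_)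
    · have : a = 0 := by
        have := Finset.mem_range.1 ha
        omega
      simp [this]
    · rw [Fin.prod_univ_two]
      simp only [Polynomial.eval_sub, Polynomial.eval_X, Polynomial.eval_C, Fin.val_zero,
        Fin.val_one, add_zero, Nat.cast_add, Nat.cast_one]
      rcases le_or_gt i (pairStart e g j) with h | h
      · have h' : (i : ℝ) ≤ pairStart e g j := by exact_mod_cast h
        exact mul_nonneg_of_nonpos_of_nonpos (by linarith) (by linarith)
      · have h' : (pairStart e g j : ℝ) + 1 ≤ i := by exact_mod_cast h
        exact mul_nonneg (by linarith) (by linarith)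
  · rintro ⟨j, s⟩ - ⟨j', s'⟩ - h
    obtain ⟨h1, -, h2⟩ := pairStart_add_inj h
    exact Prod.ext h1 h2
  · rw [Finset.disjoint_left]
    intro a ha ha'
    simp only [Finset.mem_range, Finset.mem_image, pairStart] at ha ha'
    obtain ⟨z, -, hz⟩ := ha'
    omega

/-- Polynomials with the same point differ by a constant, which is `0` because both have minimum `0`
over the naturals. -/
theorem coeffPoint_pairPoly_injective {d k m e : ℕ} (he : e ≤ 1)
    (hd : e + 2 * k = d + 1) :
    Function.Injective fun g : Fin k → Fin m => coeffPoint d (pairPoly e g) := by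
  have key : ∀ g g' : Fin k → Fin m, coeffPoint d (pairPoly e g) = coeffPoint d (pairPoly e g') →
      (pairPoly e g').coeff 0 ≤ (pairPoly e g).coeff 0 := by
    intro g g' h
    have hcard : 0 < (pairSet e g').card := by
      rw [card_pairSet]
      omega
    obtain ⟨a, ha⟩ := Finset.card_pos.1 hcard
    have h1 := momentForm_coeffPoint (pairPoly_monic e g)
      ((natDegree_pairPoly e g).trans hd) a
    have h2 := momentForm_coeffPoint (pairPoly_monic e g')
      ((natDegree_pairPoly e g').trans hd) a
    rw [eval_pairPoly_eq_zero_iff.2 ha] at h2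
    rw [h] at h1
    have h3 := eval_pairPoly_nonneg he g a
    linarith
  intro g g' h
  have h0 := le_antisymm (key g g' h) (key g' g h.symm)
  refine pairSet_injective e (Finset.ext fun i => ?_)
  have h1 := momentForm_coeffPoint (pairPoly_monic e g)
    ((natDegree_pairPoly e g).trans hd) i
  have h2 := momentForm_coeffPoint (pairPoly_monic e g')
    ((natDegree_pairPoly e g').trans hd) i
  dsimp only at h
  rw [h] at h1
  rw [← eval_pairPoly_eq_zero_iff, ← eval_pairPoly_eq_zero_iff,
    show (pairPoly e g).eval (i : ℝ) = (pairPoly e g').eval (i : ℝ) by linarith]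

theorem mainTheorem7 (d : ℕ) (hd : 4 ≤ d + 1) :
    ∃ c : ℝ, 0 < c ∧ ∀ n : ℕ, d + 1 < n →
      ∃ K : Fin n → Set (EuclideanSpace ℝ (Fin d)),
        (∀ i, Convex ℝ (K i)) ∧ (∀ i, (K i).Nonempty) ∧
        (∀ i j, i ≠ j → Disjoint (K i) (K j)) ∧
        ∃ S : Finset (EuclideanSpace ℝ (Fin d)),
          (∀ p ∈ S, IsEncapsulated K p) ∧
          c * (n : ℝ) ^ ((d + 1) / 2) ≤ (S.card : ℝ) := by
  classical
  set k := (d + 1) / 2 with hkdef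
  obtain ⟨e, he, hek⟩ : ∃ e, e ≤ 1 ∧ e + 2 * k = d + 1 := ⟨(d + 1) % 2, by omega, by omega⟩
  have hk : 0 < k := by omega
  refine ⟨(1 / (4 * k : ℝ)) ^ k, by positivity, fun n hn => ?_⟩
  -- The `- 1` reserves an index for the unpaired root `0`.
  set m := (n - 1) / (2 * k) with hm
  have hmn : m * (2 * k) ≤ n - 1 := Nat.div_mul_le_self _ _
  have hm1 : 1 ≤ m := (Nat.one_le_div_iff (by omega)).2 (by omega)
  have hnm : n ≤ 4 * k * m := by
    have h1 : n - 1 < 2 * k * (m + 1) := Nat.lt_mul_div_succ _ (by omega)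
    have h2 : 2 * k * (m + 1) ≤ 2 * k * (m + m) := Nat.mul_le_mul_left _ (by omega)
    have h3 : 2 * k * (m + m) = 4 * k * m := by ring
    omega
  let S : Finset (EuclideanSpace ℝ (Fin d)) :=
    Finset.univ.image fun g : Fin k → Fin m => coeffPoint d (pairPoly e g)
  obtain ⟨K, hK1, hK2, hK3, hK4⟩ := exists_convex_encapsulating (d := d) (n := n)
    (by omega) (by omega) (fun i x => momentForm ((i : ℕ) : ℝ) x)
    (fun i x y a b hab => momentForm_combo _ x y hab) S (by
      intro p hp i x hi hx
      obtain ⟨g, -, rfl⟩ := Finset.mem_image.1 hp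
      simp only [momentForm_coeffPoint (pairPoly_monic e g)
        ((natDegree_pairPoly e g).trans hek)] at hi hx
      have hlt : ∀ a ∈ pairSet e g, a < n := fun a ha => by
        have h1 := lt_of_mem_pairSet ha
        have h2 : m * (2 * k) = 2 * (m * k) := by ring
        omega
      have hi0 : (pairPoly e g).eval ((i : ℕ) : ℝ) = 0 := by
        have hcard : 0 < (pairSet e g).card := by
          rw [card_pairSet]
          omega
        obtain ⟨a, ha⟩ := Finset.card_pos.1 hcard
        have h1 := hi ⟨a, hlt a ha⟩
        dsimp only at h1
        rw [eval_pairPoly_eq_zero_iff.2 ha] at h1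
        have h2 := eval_pairPoly_nonneg he g i
        linarith
      refine eq_of_momentForm_sub_const (T := (pairSet e g).image ((↑) : ℕ → ℝ))
        (c := momentForm ((i : ℕ) : ℝ) x + (pairPoly e g).coeff 0) ?_ fun t ht => ?_
      · rw [Finset.card_image_of_injective _ Nat.cast_injective, card_pairSet]
        omega
      · obtain ⟨a, ha, rfl⟩ := Finset.mem_image.1 ht
        have ha0 := eval_pairPoly_eq_zero_iff.2 ha
        have h1 := hx ⟨a, hlt a ha⟩ (by simp only [ha0, hi0])
        dsimp only at h1
        rw [h1, momentForm_coeffPoint (pairPoly_monic e g)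
          ((natDegree_pairPoly e g).trans hek), ha0]
        ring)
  refine ⟨K, hK1, hK2, hK3, S, hK4, ?_⟩
  have hcard : S.card = m ^ k := by
    rw [Finset.card_image_of_injective _ (coeffPoint_pairPoly_injective he hek)]
    simp
  rw [hcard, ← mul_pow, Nat.cast_pow]
  refine pow_le_pow_left₀ (by positivity) ?_ k
  have hnm' : (n : ℝ) ≤ 4 * k * m := by exact_mod_cast hnm
  have hk' : (0 : ℝ) < 4 * k := by positivity
  rw [one_div, inv_mul_le_iff₀ hk']
  exact hnm'
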